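/- Let $L\in\mathbb{R}^{n\times n}$ be normal ($LL^T=L^TL$, i.e. unitarily diagonalizable over $\mathbb{C}$), let $B=c\,I$ with $c\in\mathbb{R}$, let $X_0\in\mathbb{R}^n$ be deterministic, let $W$ be a standard $n$-dimensional Wiener process, and let $X$ be a solution of the stochastic differential equation $dX_t=LX_t\,dt+B\,dW_t$ with initial value $X_0$. For $k\ge 1$ let $\lambda_k=(k-\tfrac12)\pi$ be the frequencies of the Karhunen–Loève expansion $W_t=\sqrt2\sum_{k\ge1}Z_k\sin(\lambda_kt)/\lambda_k$ of $W$ on $[0,1]$, and let $$\varphi^{\cos}_{k,t}(z)=\int_0^t e^{(t-s)z}\cos(\lambda_k s)\,ds=\frac{z e^{zt}-z\cos(\lambda_kt)+\lambda_k\sin(\lambda_kt)}{z^2+\lambda_k^2}\qquad(z\in\mathbb{C}),$$ where the quotient is continued analytically to $z=\pm i\lambda_k$. Then for every $t\in[0,1]$ the random vector $X_t$ is square-integrable, the series below converges, and $$\mathbb{E}\left(\|X_t\|^2\right)=\left\|e^{tL}X_0\right\|^2+2c^2\sum_{k=1}^\infty\ \sum_{\lambda\in\Lambda(L)}\left|\varphi^{\cos}_{k,t}(\lambda)\right|^2,$$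 where $\|\cdot\|$ is the Euclidean norm and $\Lambda(L)$ is the spectrum of $L$ in $\mathbb{C}$, each eigenvalue being counted with its multiplicity. -/

import Mathlib

open MeasureTheory ProbabilityTheory
open scoped NNReal

noncomputable section

/-- A standard `n`-dimensional Wiener process: the coordinates are independent (as processes)
standard real Brownian motions. -/
structure IsStandardWiener {Ω : Type*} [MeasurableSpace Ω] {n : ℕ}
    (W : ℝ≥0 → Ω → EuclideanSpace ℝ (Fin n)) (P : Measure Ω) : Prop where
  isBrownian : ∀ i : Fin n, IsBrownianReal (fun t ω => W t ω i) P
  indep : iIndepFun (fun (i : Fin n) (ω : Ω) (t : ℝ≥0) => W t ω i) P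

/-- `X` is a solution of the linear SDE with additive noise `dX_t = L X_t dt + B dW_t` with
deterministic initial value `x₀`: almost surely, the path is continuous and, for all `t ≥ 0`,
`X_t = x₀ + ∫₀ᵗ L X_s ds + ∫₀ᵗ B dW_s`. Since `B` is constant, all the Riemann sums
`∑ B (W_{t_i} - W_{t_{i-1}})` that define the Itô integral are equal to `B (W_t - W_0)`. -/
structure IsLinearSDESolution {Ω : Type*} [MeasurableSpace Ω] {n : ℕ}
    (L B : Matrix (Fin n) (Fin n) ℝ) (W : ℝ≥0 → Ω → EuclideanSpace ℝ (Fin n))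
    (x₀ : EuclideanSpace ℝ (Fin n)) (X : ℝ≥0 → Ω → EuclideanSpace ℝ (Fin n))
    (P : Measure Ω) : Prop where
  continuous_paths : ∀ᵐ ω ∂P, Continuous (fun t => X t ω)
  integral_eq : ∀ᵐ ω ∂P, ∀ t : ℝ≥0,
    X t ω = x₀ + (∫ s in (0 : ℝ)..t, L.toEuclideanLin (X s.toNNReal ω))
      + B.toEuclideanLin (W t ω - W 0 ω)

/-- The frequencies `λ_k = (k - 1/2) π`, `k = 1, 2, …`, of the Karhunen–Loève expansion
`W_t = √2 ∑_{k ≥ 1} Z_k sin (λ_k t) / λ_k` of the Wiener process on `[0, 1]`. -/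
def klFreq (k : ℕ) : ℝ := ((k : ℝ) - 1 / 2) * Real.pi

/-- The trigonometric function `φ^cos_{k,t}(z) = ∫₀ᵗ e^{(t-s)z} cos (λ_k s) ds`, an entire
function of `z`, for a sequence `lam` of real frequencies. -/
def phiCos (lam : ℕ → ℝ) (k : ℕ) (t : ℝ) (z : ℂ) : ℂ :=
  ∫ s in (0 : ℝ)..t, Complex.exp (((t : ℂ) - (s : ℂ)) * z) * Complex.cos ((lam k : ℂ) * (s : ℂ))

/-- The closed form of `phiCos`; at the removable singularities `z = ± i λ_k` the integral gives
the value of the analytic continuation. -/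
theorem phiCos_eq (lam : ℕ → ℝ) (k : ℕ) (t : ℝ) (z : ℂ) (h : z ^ 2 + (lam k : ℂ) ^ 2 ≠ 0) :
    phiCos lam k t z =
      (z * Complex.exp (z * t) - z * Complex.cos (lam k * t) + lam k * Complex.sin (lam k * t))
        / (z ^ 2 + (lam k : ℂ) ^ 2) := by
  have hd : ∀ s ∈ Set.uIcc (0 : ℝ) t, HasDerivAt (fun s : ℝ =>
      Complex.exp (((t : ℂ) - (s : ℂ)) * z) *
        (lam k * Complex.sin (lam k * s) - z * Complex.cos (lam k * s))
        / (z ^ 2 + (lam k : ℂ) ^ 2))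
      (Complex.exp (((t : ℂ) - (s : ℂ)) * z) * Complex.cos ((lam k : ℂ) * (s : ℂ))) s := by
    intro s _
    have h0 : HasDerivAt (fun s : ℝ => (s : ℂ)) 1 s := Complex.ofRealCLM.hasDerivAt
    have h1 := ((h0.const_sub (t : ℂ)).mul_const z).cexp
    have h2 := ((Complex.hasDerivAt_sin _).comp s (h0.const_mul (lam k : ℂ))).const_mul (lam k : ℂ)
    have h3 := ((Complex.hasDerivAt_cos _).comp s (h0.const_mul (lam k : ℂ))).const_mul z
    refine ((h1.mul (h2.sub h3)).div_const _).congr_deriv ?_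
    rw [div_eq_iff h]
    simp only [Pi.sub_apply, Function.comp_apply]
    ring
  unfold phiCos
  rw [intervalIntegral.integral_eq_sub_of_hasDerivAt hd
    (Continuous.intervalIntegrable (by fun_prop) _ _)]
  simp only [sub_self, zero_mul, Complex.exp_zero, Complex.ofReal_zero, mul_zero, Complex.sin_zero,
    Complex.cos_zero, sub_zero, mul_comm z (t : ℂ)]
  ring

/-- The eigenvalues of a real square matrix in `ℂ`, repeated according to (algebraic)
multiplicity. -/
def complexEigenvalues {n : ℕ} (L : Matrix (Fin n) (Fin n) ℝ) : Multiset ℂ :=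
  (L.map (algebraMap ℝ ℂ)).charpoly.roots

end

/-!
Variation of constants gives `X_t = e^{tL} x₀ + ∫₀ᵗ e^{(t-s)L} B dW_s`. The integrand is
deterministic and `C¹` in `s`, so integration by parts makes the stochastic integral a pathwise
Riemann–Stieltjes integral; as an almost sure limit of sums of independent Gaussian increments it is
Gaussian, with the variance predicted by the Itô isometry. Hence
`E ‖X_t‖² = ‖e^{tL} x₀‖² + ∫₀ᵗ tr (e^{(t-s)L} B Bᵀ e^{(t-s)Lᵀ}) ds`. For `B Bᵀ = c²` and normal `L`
the spectral theorem turns the trace into `c² ∑_λ |e^{(t-s)λ}|²`. Finally, extended by zero to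
`[0, 1]`, the function `s ↦ e^{(t-s)λ}` on `[0, t]` has the coefficients `√2 φ^cos_{k,t}(λ)` in the
orthonormal basis `√2 cos (λ_k s)` of `L²[0, 1]`, and Parseval's identity gives
`∫₀ᵗ |e^{(t-s)λ}|² ds = 2 ∑_k |φ^cos_{k,t}(λ)|²`.
-/

open Filter Topology
open scoped ENNReal Matrix

section Stieltjes

variable {E F G : Type*} [NormedAddCommGroup E] [NormedSpace ℝ E] [NormedAddCommGroup F]
  [NormedSpace ℝ F] [NormedAddCommGroup G] [NormedSpace ℝ G]

theorem norm_sum_integral_apply_sub_integral_le {u : ℝ → E →L[ℝ] F} {w : ℝ → E}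
    (hu : Continuous u) (hw : Continuous w) {a : ℕ → ℝ} (ha : Monotone a) {x : ℕ → E} {N : ℕ}
    {η : ℝ} (hx : ∀ k < N, ∀ s ∈ Set.Icc (a k) (a (k + 1)), ‖x k - w s‖ ≤ η) :
    ‖∑ k ∈ Finset.range N, (∫ s in a k..a (k + 1), u s) (x k) - ∫ s in a 0..a N, u s (w s)‖
      ≤ (∫ s in a 0..a N, ‖u s‖) * η := by
  have huw : Continuous fun s => u s (w s) := hu.clm_apply hw
  have hterm : ∀ k < N, ‖(∫ s in a k..a (k + 1), u s) (x k) - ∫ s in a k..a (k + 1), u s (w s)‖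
      ≤ (∫ s in a k..a (k + 1), ‖u s‖) * η := fun k hk => by
    rw [ContinuousLinearMap.intervalIntegral_apply (hu.intervalIntegrable _ _),
      ← intervalIntegral.integral_sub ((hu.clm_apply continuous_const).intervalIntegrable _ _)
        (huw.intervalIntegrable _ _), ← intervalIntegral.integral_mul_const]
    refine intervalIntegral.norm_integral_le_of_norm_le (ha k.le_succ)
      (Eventually.of_forall fun s hs => ?_)
      ((hu.norm.mul continuous_const).intervalIntegrable _ _)
    rw [← map_sub]
    exact (u s).le_opNorm_of_le (hx k hk s (Set.Ioc_subset_Icc_self hs))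
  rw [← intervalIntegral.sum_integral_adjacent_intervals
      fun k _ => huw.intervalIntegrable (a k) (a (k + 1)),
    ← intervalIntegral.sum_integral_adjacent_intervals
      fun k _ => hu.norm.intervalIntegrable (a k) (a (k + 1)),
    ← Finset.sum_sub_distrib, Finset.sum_mul]
  exact norm_sum_le_of_le _ fun k hk => hterm k (Finset.mem_range.1 hk)

theorem tendsto_sum_integral_apply_tag {u : ℝ → E →L[ℝ] F} {w : ℝ → E}
    (hu : Continuous u) (hw : Continuous w) {T : ℝ} (hT : 0 ≤ T) {τ : ℕ → ℕ → ℝ}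
    (hτ : ∀ N : ℕ, ∀ k : ℕ, τ N k ∈ Set.Icc (k * T / N) ((k + 1 : ℕ) * T / N)) :
    Tendsto (fun N : ℕ => ∑ k ∈ Finset.range N,
        (∫ s in (k * T / N)..((k + 1 : ℕ) * T / N), u s) (w (τ N k)))
      atTop (𝓝 (∫ s in (0 : ℝ)..T, u s (w s))) := by
  have huc := isCompact_Icc.uniformContinuousOn_of_continuous (s := Set.Icc 0 T) hw.continuousOn
  rw [Metric.tendsto_atTop]
  intro ε hε
  set C := ∫ s in (0 : ℝ)..T, ‖u s‖
  have hC : 0 ≤ C := intervalIntegral.integral_nonneg hT fun s _ => norm_nonneg _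
  obtain ⟨δ, hδ, hwδ⟩ := Metric.uniformContinuousOn_iff_le.1 huc (ε / (C + 1)) (by positivity)
  obtain ⟨N₀, hN₀⟩ := exists_nat_gt (T / δ)
  refine ⟨N₀ + 1, fun N hN => ?_⟩
  have hNpos : (0 : ℝ) < N := by exact_mod_cast (by omega : 0 < N)
  have hmesh : T / N ≤ δ := by
    rw [div_le_comm₀ hNpos hδ]
    exact hN₀.le.trans (by exact_mod_cast (by omega : N₀ ≤ N))
  have hmono : Monotone fun k : ℕ => k * T / N := fun k l hkl => by dsimp only; gcongr
  have hend : (N : ℝ) * T / N = T := mul_div_cancel_left₀ T hNpos.ne'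
  have htag : ∀ k < N, ∀ s ∈ Set.Icc (k * T / N) ((k + 1 : ℕ) * T / N),
      ‖w (τ N k) - w s‖ ≤ ε / (C + 1) := fun k hk s hs => by
    have hsub : Set.Icc (k * T / N) ((k + 1 : ℕ) * T / N) ⊆ Set.Icc 0 T :=
      Set.Icc_subset_Icc (by positivity) ((hmono hk).trans_eq hend)
    rw [← dist_eq_norm]
    refine hwδ _ (hsub (hτ N k)) _ (hsub hs) ((Real.dist_le_of_mem_Icc (hτ N k) hs).trans ?_)
    exact le_of_eq_of_le (by push_cast; ring) hmesh
  have h := norm_sum_integral_apply_sub_integral_le hu hw hmono htag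
  simp only [hend, Nat.cast_zero, zero_mul, zero_div] at h
  rw [dist_eq_norm]
  refine h.trans_lt ?_
  rw [← mul_div_assoc, div_lt_iff₀ (by positivity)]
  nlinarith

theorem tendsto_sum_mul_left_endpoint {w : ℝ → ℝ} (hw : Continuous w) {T : ℝ} (hT : 0 ≤ T) :
    Tendsto (fun N : ℕ => ∑ k ∈ Finset.range N,
        w (k * T / N) * ((k + 1 : ℕ) * T / N - k * T / N))
      atTop (𝓝 (∫ s in (0 : ℝ)..T, w s)) := by
  have h := tendsto_sum_integral_apply_tag (u := fun _ => ContinuousLinearMap.id ℝ ℝ)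
    continuous_const hw hT (τ := fun N k => k * T / N)
    fun N k => ⟨le_rfl, by push_cast; gcongr; linarith⟩
  simpa [mul_comm] using h

/-- The Riemann–Stieltjes integral `∫₀ᵀ H dw` of a `C¹` integrand `H` against a continuous path
`w`. It is defined through integration by parts, so that `w` need not have bounded variation. -/
noncomputable def stieltjesIntegral (H : ℝ → E →L[ℝ] F) (w : ℝ → E) (T : ℝ) : F :=
  H T (w T) - H 0 (w 0) - ∫ s in (0 : ℝ)..T, deriv H s (w s)

theorem tendsto_sum_stieltjesIntegral [CompleteSpace F] {H : ℝ → E →L[ℝ] F} {w : ℝ → E}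
    (hH : ContDiff ℝ 1 H) (hw : Continuous w) {T : ℝ} (hT : 0 ≤ T) :
    Tendsto (fun N : ℕ => ∑ k ∈ Finset.range N,
        H (k * T / N) (w ((k + 1 : ℕ) * T / N) - w (k * T / N)))
      atTop (𝓝 (stieltjesIntegral H w T)) := by
  have hH' : Continuous (deriv H) := hH.continuous_deriv_one
  have hlim := (tendsto_sum_integral_apply_tag hH' hw hT (τ := fun N k => (k + 1 : ℕ) * T / N)
    fun N k => ⟨by push_cast; gcongr; linarith, le_rfl⟩).const_sub (H T (w T) - H 0 (w 0))
  refine hlim.congr' ?_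
  filter_upwards [eventually_ne_atTop 0] with N hN
  have hftc : ∀ k : ℕ, ∫ s in (k * T / N)..((k + 1 : ℕ) * T / N), deriv H s =
      H ((k + 1 : ℕ) * T / N) - H (k * T / N) := fun k =>
    intervalIntegral.integral_deriv_eq_sub
      (fun s _ => (hH.differentiable one_ne_zero).differentiableAt) (hH'.intervalIntegrable _ _)
  have htel := Finset.sum_range_sub (fun k : ℕ => H (k * T / N) (w (k * T / N))) N
  simp only [mul_div_cancel_left₀ T (Nat.cast_ne_zero.2 hN : (N : ℝ) ≠ 0), Nat.cast_zero, zero_mul,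
    zero_div] at htel
  rw [← htel, ← Finset.sum_sub_distrib]
  refine Finset.sum_congr rfl fun k _ => ?_
  rw [hftc, sub_apply, map_sub]
  abel

theorem map_stieltjesIntegral [CompleteSpace F] [CompleteSpace G] (ψ : F →L[ℝ] G)
    {H : ℝ → E →L[ℝ] F} {w : ℝ → E} (hH : ContDiff ℝ 1 H) (hw : Continuous w) (T : ℝ) :
    ψ (stieltjesIntegral H w T) = stieltjesIntegral (fun s => ψ ∘L H s) w T := by
  have hderiv : ∀ s, deriv (fun s => ψ ∘L H s) s = ψ ∘L deriv H s := fun s =>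
    ((hasDerivAt_const s ψ).clm_comp
      (hH.differentiable one_ne_zero s).hasDerivAt).deriv.trans (by simp)
  simp only [stieltjesIntegral, hderiv, map_sub, ContinuousLinearMap.comp_apply]
  rw [← ψ.intervalIntegral_comp_comm
    ((hH.continuous_deriv_one.clm_apply hw).intervalIntegrable _ _)]

end Stieltjes

section VariationOfConstants

variable {E G : Type*} [NormedAddCommGroup E] [NormedSpace ℝ E] [CompleteSpace E]
  [NormedAddCommGroup G] [NormedSpace ℝ G]

theorem hasDerivAt_exp_sub_smul_comp (A : E →L[ℝ] E) (B : G →L[ℝ] E) (t s : ℝ) :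
    HasDerivAt (fun s => NormedSpace.exp ((t - s) • A) ∘L B)
      (-(NormedSpace.exp ((t - s) • A) ∘L A ∘L B)) s := by
  have h : HasDerivAt (fun s => NormedSpace.exp ((t - s) • A))
      ((-1 : ℝ) • (NormedSpace.exp ((t - s) • A) * A)) s :=
    (hasDerivAt_exp_smul_const (𝕂 := ℝ) A (t - s)).scomp s ((hasDerivAt_id s).const_sub t)
  exact (h.clm_comp (hasDerivAt_const s B)).congr_deriv (by ext; simp)

theorem contDiff_exp_sub_smul_comp (A : E →L[ℝ] E) (B : G →L[ℝ] E) (t : ℝ) :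
    ContDiff ℝ 1 fun s => NormedSpace.exp ((t - s) • A) ∘L B := by
  have hexp : ContDiff ℝ 1 (NormedSpace.exp : (E →L[ℝ] E) → E →L[ℝ] E) :=
    contDiff_iff_contDiffAt.2 fun x => (NormedSpace.exp_analytic (𝕂 := ℝ) x).contDiffAt
  exact (hexp.comp (by fun_prop)).clm_comp contDiff_const

theorem eq_exp_smul_add_integral_of_hasDerivAt {A : E →L[ℝ] E} {Z f : ℝ → E} (hf : Continuous f)
    {t : ℝ} (h : ∀ s ∈ Set.uIcc 0 t, HasDerivAt Z (A (Z s) + f s) s) :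
    Z t = NormedSpace.exp (t • A) (Z 0) +
      ∫ s in (0 : ℝ)..t, NormedSpace.exp ((t - s) • A) (f s) := by
  have hderiv : ∀ s ∈ Set.uIcc 0 t,
      HasDerivAt (fun s => NormedSpace.exp ((t - s) • A) (Z s))
        (NormedSpace.exp ((t - s) • A) (f s)) s := fun s hs =>
    ((hasDerivAt_exp_sub_smul_comp A (ContinuousLinearMap.id ℝ E) t s).clm_apply
      (h s hs)).congr_deriv (by simp)
  have hcont : Continuous fun s => NormedSpace.exp ((t - s) • A) (f s) :=
    (contDiff_exp_sub_smul_comp A (ContinuousLinearMap.id ℝ E) t).continuous.clm_apply hf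
  rw [intervalIntegral.integral_eq_sub_of_hasDerivAt hderiv (hcont.intervalIntegrable _ _)]
  simp

theorem eq_exp_smul_add_stieltjesIntegral_of_integral_eq {A : E →L[ℝ] E} {B : G →L[ℝ] E}
    {Y : ℝ → E} {w : ℝ → G} (hY : Continuous Y) (hw : Continuous w) {y : E} {t : ℝ} (ht : 0 ≤ t)
    (h : ∀ s ∈ Set.Icc 0 t, Y s = y + (∫ r in (0 : ℝ)..s, A (Y r)) + B (w s - w 0)) :
    Y t = NormedSpace.exp (t • A) y +
      stieltjesIntegral (fun s => NormedSpace.exp ((t - s) • A) ∘L B) w t := by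
  set Z : ℝ → E := fun s => y - B (w 0) + ∫ r in (0 : ℝ)..s, A (Y r) with hZ
  have hYZ : ∀ s ∈ Set.Icc 0 t, Y s = Z s + B (w s) := fun s hs => by
    simp only [h s hs, hZ, map_sub]
    abel
  have hderiv : ∀ s ∈ Set.uIcc 0 t, HasDerivAt Z (A (Z s) + A (B (w s))) s := fun s hs => by
    rw [Set.uIcc_of_le ht] at hs
    rw [← map_add, ← hYZ s hs]
    exact ((A.continuous.comp hY).integral_hasStrictDerivAt 0 s).hasDerivAt.const_add _
  have hZt := eq_exp_smul_add_integral_of_hasDerivAt (by fun_prop) hderiv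
  have hZ0 : Z 0 = y - B (w 0) := by simp [hZ]
  rw [hZ0, map_sub] at hZt
  rw [hYZ t ⟨ht, le_rfl⟩, hZt, stieltjesIntegral]
  simp only [(hasDerivAt_exp_sub_smul_comp A B t _).deriv, neg_apply, intervalIntegral.integral_neg,
    ContinuousLinearMap.comp_apply, sub_self, zero_smul, NormedSpace.exp_zero, one_apply_eq_self,
    sub_zero]
  abel

end VariationOfConstants

section Gaussian

variable {Ω : Type*} [MeasurableSpace Ω] {P : Measure Ω} [IsProbabilityMeasure P]

theorem hasLaw_gaussianReal_sum {ι : Type*} {R : ι → Ω → ℝ} {m : ι → ℝ} {v : ι → ℝ≥0}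
    (hind : iIndepFun R P) (h : ∀ i, HasLaw (R i) (gaussianReal (m i) (v i)) P) (s : Finset ι) :
    HasLaw (fun ω => ∑ i ∈ s, R i ω) (gaussianReal (∑ i ∈ s, m i) (∑ i ∈ s, v i)) P where
  aemeasurable := Finset.aemeasurable_fun_sum s fun i _ => (h i).aemeasurable
  map_eq := by
    refine Measure.ext_of_charFun (funext fun u => ?_)
    rw [(hind.restrict s).charFun_map_fun_finsetSum_eq_prod fun i _ => (h i).aemeasurable,
      Finset.prod_apply]
    simp_rw [(h _).map_eq, charFun_gaussianReal, ← Complex.exp_sum, Finset.sum_sub_distrib,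
      ← Finset.sum_div, ← Finset.sum_mul, ← Finset.mul_sum]
    push_cast
    rfl

theorem hasLaw_gaussianReal_of_tendsto {S : ℕ → Ω → ℝ} {R : Ω → ℝ} {m : ℕ → ℝ} {μ : ℝ}
    {v : ℕ → ℝ≥0} {σ : ℝ≥0} (hS : ∀ N, HasLaw (S N) (gaussianReal (m N) (v N)) P)
    (hR : ∀ᵐ ω ∂P, Tendsto (fun N => S N ω) atTop (𝓝 (R ω)))
    (hm : Tendsto m atTop (𝓝 μ)) (hv : Tendsto v atTop (𝓝 σ)) :
    HasLaw R (gaussianReal μ σ) P := by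
  have hdist := tendstoInDistribution_of_ae_tendsto (fun N => (hS N).aemeasurable)
    (aemeasurable_of_tendsto_metrizable_ae' (fun N => (hS N).aemeasurable) hR) hR
  refine ⟨hdist.aemeasurable_limit, Measure.ext_of_charFun (funext fun u => ?_)⟩
  have hchar := ProbabilityMeasure.tendsto_iff_tendsto_charFun.1 hdist.tendsto u
  refine tendsto_nhds_unique hchar ?_
  simp only [ProbabilityMeasure.coe_mk, (hS _).map_eq, charFun_gaussianReal]
  have hm' := (Complex.continuous_ofReal.tendsto μ).comp hm
  have hv' := (Complex.continuous_ofReal.tendsto σ).comp (NNReal.tendsto_coe.2 hv)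
  exact (((hm'.const_mul _).mul_const _).sub ((hv'.mul_const _).div_const _)).cexp

theorem integral_sq_of_hasLaw_gaussianReal {R : Ω → ℝ} {m : ℝ} {v : ℝ≥0}
    (h : HasLaw R (gaussianReal m v) P) : ∫ ω, R ω ^ 2 ∂P = m ^ 2 + v := by
  have hvar := variance_eq_sub h.hasGaussianLaw.memLp_two
  rw [h.variance_eq, h.integral_eq, variance_id_gaussianReal, integral_id_gaussianReal] at hvar
  simp only [Pi.pow_apply] at hvar
  linarith

end Gaussian

section Wiener

variable {Ω : Type*} [MeasurableSpace Ω] {P : Measure Ω}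

theorem hasLaw_sum_mul_sub_of_isPreBrownianReal {B : ℝ≥0 → Ω → ℝ} (hB : IsPreBrownianReal B P)
    {r : ℕ → ℝ≥0} (hr : Monotone r) (a : ℕ → ℝ) (N : ℕ) :
    HasLaw (fun ω => ∑ k ∈ Finset.range N, a k * (B (r (k + 1)) ω - B (r k) ω))
      (gaussianReal 0 (∑ k ∈ Finset.range N, ‖a k‖₊ ^ 2 * (r (k + 1) - r k))) P := by
  have := hB.isGaussianProcess.isProbabilityMeasure
  have hind : iIndepFun (fun k ω => a k * (B (r (k + 1)) ω - B (r k) ω)) P :=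
    (hB.hasIndepIncrements.nat hr).comp (fun k x => a k * x) fun k => by fun_prop
  have hlaw : ∀ k, HasLaw (fun ω => a k * (B (r (k + 1)) ω - B (r k) ω))
      (gaussianReal 0 (‖a k‖₊ ^ 2 * (r (k + 1) - r k))) P := fun k => by
    have h := gaussianReal_const_mul (hB.hasLaw_sub (r (k + 1)) (r k)) (a k)
    have hvar : NNReal.mk (a k ^ 2) (sq_nonneg _) * nndist (r (k + 1)).1 (r k).1 =
        ‖a k‖₊ ^ 2 * (r (k + 1) - r k) := by
      ext
      simp [NNReal.coe_sub (hr k.le_succ), Real.dist_eq, abs_of_nonneg, hr k.le_succ]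
    rwa [mul_zero, hvar] at h
  simpa using hasLaw_gaussianReal_sum hind hlaw (Finset.range N)

theorem apply_eq_sum_smul_apply_single {ι F : Type*} [Fintype ι] [DecidableEq ι]
    [NormedAddCommGroup F] [NormedSpace ℝ F] (a : EuclideanSpace ℝ ι →L[ℝ] F)
    (x : EuclideanSpace ℝ ι) : a x = ∑ i, x i • a (EuclideanSpace.single i 1) := by
  conv_lhs => rw [← (EuclideanSpace.basisFun ι ℝ).sum_repr x]
  simp

variable {n : ℕ} {W : ℝ≥0 → Ω → EuclideanSpace ℝ (Fin n)}

theorem IsStandardWiener.hasLaw_sum_apply_sub (hW : IsStandardWiener W P) {r : ℕ → ℝ≥0}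
    (hr : Monotone r) (a : ℕ → EuclideanSpace ℝ (Fin n) →L[ℝ] ℝ) (N : ℕ) :
    HasLaw (fun ω => ∑ k ∈ Finset.range N, a k (W (r (k + 1)) ω - W (r k) ω))
      (gaussianReal 0 (∑ k ∈ Finset.range N,
        (∑ i, ‖a k (EuclideanSpace.single i 1)‖₊ ^ 2) * (r (k + 1) - r k))) P := by
  have := hW.indep.isProbabilityMeasure
  have hind : iIndepFun (fun i ω => ∑ k ∈ Finset.range N,
      a k (EuclideanSpace.single i 1) * (W (r (k + 1)) ω i - W (r k) ω i)) P :=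
    hW.indep.comp (fun i b => ∑ k ∈ Finset.range N,
      a k (EuclideanSpace.single i 1) * (b (r (k + 1)) - b (r k))) fun i => by fun_prop
  have h := hasLaw_gaussianReal_sum hind (fun i => hasLaw_sum_mul_sub_of_isPreBrownianReal
    (hW.isBrownian i).toIsPreBrownianReal hr _ N) Finset.univ
  rw [Finset.sum_const_zero, Finset.sum_comm] at h
  simp_rw [← Finset.sum_mul] at h
  refine h.congr (Eventually.of_forall fun ω => ?_)
  dsimp only
  rw [Finset.sum_comm]
  refine Finset.sum_congr rfl fun k _ => ?_
  rw [apply_eq_sum_smul_apply_single]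
  simp [mul_comm]

theorem IsStandardWiener.continuous_paths (hW : IsStandardWiener W P) :
    ∀ᵐ ω ∂P, Continuous fun s => W s ω := by
  filter_upwards [ae_all_iff.2 fun i => (hW.isBrownian i).cont] with ω hω
  exact (PiLp.continuous_toLp 2 _).comp (continuous_pi hω)

theorem tendsto_sum_stieltjesIntegral_nnreal {E F : Type*} [NormedAddCommGroup E]
    [NormedSpace ℝ E] [NormedAddCommGroup F] [NormedSpace ℝ F] [CompleteSpace F]
    {H : ℝ → E →L[ℝ] F} {w : ℝ≥0 → E} (hH : ContDiff ℝ 1 H) (hw : Continuous w) (t : ℝ≥0) :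
    Tendsto (fun N : ℕ => ∑ k ∈ Finset.range N,
        H (k * t / N) (w ((k + 1 : ℕ) * t / N) - w (k * t / N)))
      atTop (𝓝 (stieltjesIntegral H (fun s => w s.toNNReal) t)) := by
  have hmesh : ∀ N k : ℕ, (k * t / N : ℝ).toNNReal = k * t / N := fun N k => by
    rw [← Real.toNNReal_coe (r := k * t / N)]
    push_cast
    rfl
  simpa only [hmesh] using
    tendsto_sum_stieltjesIntegral (w := fun s => w s.toNNReal) hH
      (hw.comp continuous_real_toNNReal) t.coe_nonneg

theorem IsStandardWiener.hasLaw_stieltjesIntegral (hW : IsStandardWiener W P)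
    {h : ℝ → EuclideanSpace ℝ (Fin n) →L[ℝ] ℝ} (hh : ContDiff ℝ 1 h) (t : ℝ≥0) :
    HasLaw (fun ω => stieltjesIntegral h (fun s => W s.toNNReal ω) t)
      (gaussianReal 0
        (∫ s in (0 : ℝ)..t, ∑ i, h s (EuclideanSpace.single i 1) ^ 2).toNNReal) P := by
  have := hW.indep.isProbabilityMeasure
  set r : ℕ → ℕ → ℝ≥0 := fun N k => k * t / N with hr
  have hmono : ∀ N, Monotone (r N) := fun N k l hkl => by simp only [hr]; gcongr
  have hpath : ∀ᵐ ω ∂P, Tendsto (fun N => ∑ k ∈ Finset.range N,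
      h (r N k) (W (r N (k + 1)) ω - W (r N k) ω)) atTop
      (𝓝 (stieltjesIntegral h (fun s => W s.toNNReal ω) t)) := by
    filter_upwards [hW.continuous_paths] with ω hω
    simpa [hr] using tendsto_sum_stieltjesIntegral_nnreal hh hω t
  have hvar : Tendsto (fun N => ∑ k ∈ Finset.range N,
      (∑ i, ‖h (r N k) (EuclideanSpace.single i 1)‖₊ ^ 2) * (r N (k + 1) - r N k)) atTop
      (𝓝 (∫ s in (0 : ℝ)..t, ∑ i, h s (EuclideanSpace.single i 1) ^ 2).toNNReal) := by
    have hcont : Continuous fun s => ∑ i, h s (EuclideanSpace.single i 1) ^ 2 :=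
      continuous_finsetSum _ fun i _ => (hh.continuous.clm_apply continuous_const).pow 2
    have hnonneg : 0 ≤ ∫ s in (0 : ℝ)..t, ∑ i, h s (EuclideanSpace.single i 1) ^ 2 :=
      intervalIntegral.integral_nonneg t.coe_nonneg fun s _ => by positivity
    rw [← NNReal.tendsto_coe, Real.coe_toNNReal _ hnonneg]
    push_cast
    simp only [NNReal.coe_sub (hmono _ (Nat.le_succ _)), Real.norm_eq_abs, sq_abs]
    simpa [hr] using tendsto_sum_mul_left_endpoint hcont t.coe_nonneg
  exact hasLaw_gaussianReal_of_tendsto (fun N => hW.hasLaw_sum_apply_sub (hmono N) _ N) hpath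
    tendsto_const_nhds hvar

variable {F : Type*} [NormedAddCommGroup F] [InnerProductSpace ℝ F] [FiniteDimensional ℝ F]
  {H : ℝ → EuclideanSpace ℝ (Fin n) →L[ℝ] F}

theorem memLp_of_forall_inner {f : Ω → F} {p : ℝ≥0∞}
    (h : ∀ v : F, MemLp (fun ω => inner ℝ v (f ω)) p P) : MemLp f p P := by
  have hsum : f = fun ω =>
      ∑ j, inner ℝ (stdOrthonormalBasis ℝ F j) (f ω) • stdOrthonormalBasis ℝ F j :=
    funext fun ω => ((stdOrthonormalBasis ℝ F).sum_repr' (f ω)).symm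
  rw [hsum]
  exact memLp_finsetSum _ fun j _ =>
    (ContinuousLinearMap.toSpanSingleton ℝ (stdOrthonormalBasis ℝ F j)).comp_memLp' (h _)

theorem IsStandardWiener.hasLaw_inner_add_stieltjesIntegral (hW : IsStandardWiener W P)
    (hH : ContDiff ℝ 1 H) (a v : F) (t : ℝ≥0) :
    HasLaw (fun ω => inner ℝ v (a + stieltjesIntegral H (fun s => W s.toNNReal ω) t))
      (gaussianReal (inner ℝ v a)
        (∫ s in (0 : ℝ)..t, ∑ i, inner ℝ v (H s (EuclideanSpace.single i 1)) ^ 2).toNNReal) P := by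
  have h := gaussianReal_const_add (hW.hasLaw_stieltjesIntegral
    (h := fun s => innerSL ℝ v ∘L H s) (contDiff_const.clm_comp hH) t) (inner ℝ v a)
  rw [zero_add] at h
  refine h.congr ?_
  filter_upwards [hW.continuous_paths] with ω hω
  exact (inner_add_right v a _).trans (congrArg _
    (map_stieltjesIntegral (innerSL ℝ v) hH (hω.comp continuous_real_toNNReal) t))

theorem IsStandardWiener.memLp_add_stieltjesIntegral (hW : IsStandardWiener W P)
    (hH : ContDiff ℝ 1 H) (a : F) (t : ℝ≥0) :
    MemLp (fun ω => a + stieltjesIntegral H (fun s => W s.toNNReal ω) t) 2 P :=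
  memLp_of_forall_inner fun v =>
    (hW.hasLaw_inner_add_stieltjesIntegral hH a v t).hasGaussianLaw.memLp_two

theorem IsStandardWiener.integral_norm_sq_add_stieltjesIntegral (hW : IsStandardWiener W P)
    (hH : ContDiff ℝ 1 H) (a : F) (t : ℝ≥0) :
    ∫ ω, ‖a + stieltjesIntegral H (fun s => W s.toNNReal ω) t‖ ^ 2 ∂P =
      ‖a‖ ^ 2 + ∫ s in (0 : ℝ)..t, ∑ i, ‖H s (EuclideanSpace.single i 1)‖ ^ 2 := by
  have := hW.indep.isProbabilityMeasure
  set b := stdOrthonormalBasis ℝ F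
  have hlaw := fun j => hW.hasLaw_inner_add_stieltjesIntegral hH a (b j) t
  have hcont : ∀ j, Continuous fun s => ∑ i, inner ℝ (b j) (H s (EuclideanSpace.single i 1)) ^ 2 :=
    fun j => continuous_finsetSum _ fun i _ =>
      (continuous_const.inner (hH.continuous.clm_apply continuous_const)).pow 2
  have hnonneg : ∀ j, 0 ≤ ∫ s in (0 : ℝ)..t,
      ∑ i, inner ℝ (b j) (H s (EuclideanSpace.single i 1)) ^ 2 := fun j =>
    intervalIntegral.integral_nonneg t.coe_nonneg fun s _ => by positivity
  have hnorm : ∀ x : F, ‖x‖ ^ 2 = ∑ j, inner ℝ (b j) x ^ 2 := fun x => by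
    simpa using (b.sum_sq_norm_inner_right x).symm
  simp_rw [hnorm, Finset.sum_comm (s := (Finset.univ : Finset (Fin n)))]
  rw [integral_finsetSum _ fun j _ => (hlaw j).hasGaussianLaw.memLp_two.integrable_sq,
    intervalIntegral.integral_finsetSum fun j _ => (hcont j).intervalIntegrable _ _]
  simp_rw [integral_sq_of_hasLaw_gaussianReal (hlaw _), Real.coe_toNNReal _ (hnonneg _)]
  exact Finset.sum_add_distrib

end Wiener

section LinearSDE

variable {ι : Type*} [Fintype ι] [DecidableEq ι]

theorem sum_norm_sq_toEuclideanCLM_single (M : Matrix ι ι ℝ) :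
    ∑ i, ‖Matrix.toEuclideanCLM (𝕜 := ℝ) M (EuclideanSpace.single i 1)‖ ^ 2 =
      (M * Mᵀ).trace := by
  simp_rw [EuclideanSpace.norm_sq_eq, Matrix.ofLp_toEuclideanCLM, PiLp.ofLp_single,
    Matrix.mulVec_single_one, Matrix.trace, Matrix.diag_apply, Matrix.mul_apply]
  rw [Finset.sum_comm]
  simp [← sq]

open scoped Matrix.Norms.Operator in
theorem toEuclideanCLM_exp (M : Matrix ι ι ℝ) :
    Matrix.toEuclideanCLM (𝕜 := ℝ) (NormedSpace.exp M) =
      NormedSpace.exp (Matrix.toEuclideanCLM (𝕜 := ℝ) M) :=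
  NormedSpace.map_exp (Matrix.toEuclideanCLM (n := ι) (𝕜 := ℝ))
    (LinearMap.continuous_of_finiteDimensional
      (Matrix.toEuclideanCLM (n := ι) (𝕜 := ℝ)).toAlgEquiv.toLinearMap) M

theorem toEuclideanCLM_exp_smul_mul (s : ℝ) (L B : Matrix ι ι ℝ) :
    Matrix.toEuclideanCLM (𝕜 := ℝ) (NormedSpace.exp (s • L) * B) =
      NormedSpace.exp (s • Matrix.toEuclideanCLM (𝕜 := ℝ) L) ∘L
        Matrix.toEuclideanCLM (𝕜 := ℝ) B := by
  rw [map_mul, toEuclideanCLM_exp, map_smul]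
  rfl

theorem contDiff_toEuclideanCLM_exp_mul (L B : Matrix ι ι ℝ) (t : ℝ) :
    ContDiff ℝ 1 fun s => Matrix.toEuclideanCLM (𝕜 := ℝ) (NormedSpace.exp ((t - s) • L) * B) := by
  simp_rw [toEuclideanCLM_exp_smul_mul]
  exact contDiff_exp_sub_smul_comp _ _ t

variable {n : ℕ} {Ω : Type*} [MeasurableSpace Ω] {P : Measure Ω}
  {L B : Matrix (Fin n) (Fin n) ℝ} {W : ℝ≥0 → Ω → EuclideanSpace ℝ (Fin n)}
  {x₀ : EuclideanSpace ℝ (Fin n)} {X : ℝ≥0 → Ω → EuclideanSpace ℝ (Fin n)}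

theorem IsLinearSDESolution.ae_eq_exp_add_stieltjesIntegral (hX : IsLinearSDESolution L B W x₀ X P)
    (hW : IsStandardWiener W P) (t : ℝ≥0) :
    X t =ᵐ[P] fun ω => (NormedSpace.exp ((t : ℝ) • L)).toEuclideanLin x₀ + stieltjesIntegral
      (fun s => Matrix.toEuclideanCLM (𝕜 := ℝ) (NormedSpace.exp ((t - s) • L) * B))
      (fun s => W s.toNNReal ω) t := by
  filter_upwards [hX.continuous_paths, hX.integral_eq, hW.continuous_paths] with ω hXω heq hWω
  have h := eq_exp_smul_add_stieltjesIntegral_of_integral_eq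
    (A := Matrix.toEuclideanCLM (𝕜 := ℝ) L) (B := Matrix.toEuclideanCLM (𝕜 := ℝ) B) (y := x₀)
    (hXω.comp continuous_real_toNNReal) (hWω.comp continuous_real_toNNReal) t.coe_nonneg
    fun s hs => by
      have h := heq s.toNNReal
      rw [Real.coe_toNNReal s hs.1, ← Real.toNNReal_zero] at h
      exact h
  simp_rw [← toEuclideanCLM_exp_smul_mul] at h
  rw [← map_smul, ← toEuclideanCLM_exp, Function.comp_apply, Real.toNNReal_coe] at h
  exact h

theorem IsLinearSDESolution.memLp_two (hX : IsLinearSDESolution L B W x₀ X P)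
    (hW : IsStandardWiener W P) (t : ℝ≥0) : MemLp (X t) 2 P :=
  (memLp_congr_ae (hX.ae_eq_exp_add_stieltjesIntegral hW t)).2
    (hW.memLp_add_stieltjesIntegral (contDiff_toEuclideanCLM_exp_mul L B t) _ t)

theorem IsLinearSDESolution.integral_norm_sq (hX : IsLinearSDESolution L B W x₀ X P)
    (hW : IsStandardWiener W P) (t : ℝ≥0) :
    ∫ ω, ‖X t ω‖ ^ 2 ∂P = ‖(NormedSpace.exp ((t : ℝ) • L)).toEuclideanLin x₀‖ ^ 2 +
      ∫ s in (0 : ℝ)..t, (NormedSpace.exp ((t - s) • L) * B *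
        (NormedSpace.exp ((t - s) • L) * B)ᵀ).trace := by
  have hae := (hX.ae_eq_exp_add_stieltjesIntegral hW t).mono fun ω h => congrArg (‖·‖ ^ 2) h
  simp_rw [integral_congr_ae hae, hW.integral_norm_sq_add_stieltjesIntegral
    (contDiff_toEuclideanCLM_exp_mul L B t) _ t, sum_norm_sq_toEuclideanCLM_single]

end LinearSDE

section SpectralTheorem

theorem exists_orthonormalBasis_apply_eq_smul_of_commute {𝕜 E : Type*} [RCLike 𝕜]
    [NormedAddCommGroup E] [InnerProductSpace 𝕜 E] [FiniteDimensional 𝕜 E] {S T : E →ₗ[𝕜] E}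
    (hS : S.IsSymmetric) (hT : T.IsSymmetric) (hST : Commute S T) :
    ∃ (b : OrthonormalBasis (Fin (Module.finrank 𝕜 E)) 𝕜 E)
      (μ ν : Fin (Module.finrank 𝕜 E) → 𝕜), ∀ i, S (b i) = μ i • b i ∧ T (b i) = ν i • b i := by
  classical
  have horth := hS.orthogonalFamily_eigenspace_inf_eigenspace hT
  have hinternal := DirectSum.isInternal_ne_bot_iff.2 (hS.directSum_isInternal_of_commute hT hST)
  have horth' := horth.comp (γ := {i : 𝕜 × 𝕜 //
    Module.End.eigenspace S i.2 ⊓ Module.End.eigenspace T i.1 ≠ ⊥}) Subtype.val_injective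
  let := horth.independent.fintypeNeBotOfFiniteDimensional
  let ix := fun i => hinternal.subordinateOrthonormalBasisIndex rfl i horth'
  refine ⟨hinternal.subordinateOrthonormalBasis rfl horth', fun i => (ix i).1.2,
    fun i => (ix i).1.1, fun i => ?_⟩
  obtain ⟨hSi, hTi⟩ := hinternal.subordinateOrthonormalBasis_subordinate rfl i horth'
  exact ⟨Module.End.mem_eigenspace_iff.1 hSi, Module.End.mem_eigenspace_iff.1 hTi⟩

open scoped ComplexStarModule in
theorem exists_orthonormalBasis_apply_eq_smul_of_isStarNormal {E : Type*} [NormedAddCommGroup E]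
    [InnerProductSpace ℂ E] [FiniteDimensional ℂ E] [CompleteSpace E] (T : E →L[ℂ] E)
    [IsStarNormal T] :
    ∃ (b : OrthonormalBasis (Fin (Module.finrank ℂ E)) ℂ E) (d : Fin (Module.finrank ℂ E) → ℂ),
      ∀ i, T (b i) = d i • b i := by
  have hsymm : ∀ S : selfAdjoint (E →L[ℂ] E), (S : E →L[ℂ] E).IsSymmetric := fun S =>
    ContinuousLinearMap.isSelfAdjoint_iff_isSymmetric.1 S.2
  have hcomm : Commute (ℜ T : E →L[ℂ] E) (ℑ T : E →L[ℂ] E) := Commute.realPart_imaginaryPart T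
  obtain ⟨b, μ, ν, hb⟩ := exists_orthonormalBasis_apply_eq_smul_of_commute (hsymm (ℜ T))
    (hsymm (ℑ T)) (hcomm.map (ContinuousLinearMap.toLinearMapRingHom))
  refine ⟨b, fun i => μ i + Complex.I * ν i, fun i => ?_⟩
  obtain ⟨hre, him⟩ := hb i
  rw [ContinuousLinearMap.coe_coe] at hre him
  calc T (b i) = ((ℜ T : E →L[ℂ] E) + Complex.I • (ℑ T : E →L[ℂ] E)) (b i) := by
        rw [realPart_add_I_smul_imaginaryPart]
    _ = _ := by
        rw [add_apply, smul_apply, hre, him, smul_smul, ← add_smul]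

theorem map_algebraMap_star {ι : Type*} (M : Matrix ι ι ℝ) :
    (star M).map (algebraMap ℝ ℂ) = star (M.map (algebraMap ℝ ℂ)) :=
  Matrix.conjTranspose_map _ fun r => (Complex.conj_ofReal r).symm

theorem isStarNormal_map_algebraMap {ι : Type*} [Fintype ι] {L : Matrix ι ι ℝ}
    (hL : IsStarNormal L) :
    IsStarNormal (L.map (algebraMap ℝ ℂ)) where
  star_comm_self := by
    classical
    rw [← map_algebraMap_star]
    exact hL.star_comm_self.map (algebraMap ℝ ℂ).mapMatrix

variable {ι : Type*} [Fintype ι] [DecidableEq ι]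

theorem exists_conjStarAlgAut_diagonal_eq_of_isStarNormal (A : Matrix ι ι ℂ) [IsStarNormal A] :
    ∃ (U : Matrix.unitaryGroup ι ℂ) (d : ι → ℂ),
      Unitary.conjStarAlgAut ℂ _ U (Matrix.diagonal d) = A := by
  have : IsStarNormal (Matrix.toEuclideanCLM (𝕜 := ℂ) A) := ‹IsStarNormal A›.map _
  obtain ⟨b, d, hb⟩ := exists_orthonormalBasis_apply_eq_smul_of_isStarNormal
    (Matrix.toEuclideanCLM (𝕜 := ℂ) A)
  let e : Fin (Module.finrank ℂ (EuclideanSpace ℂ ι)) ≃ ι :=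
    Fintype.equivOfCardEq (by simp)
  let U : Matrix.unitaryGroup ι ℂ := ⟨(EuclideanSpace.basisFun ι ℂ).toBasis.toMatrix (b.reindex e),
    OrthonormalBasis.toMatrix_orthonormalBasis_mem_unitary _ _⟩
  refine ⟨U, d ∘ e.symm, ?_⟩
  have hAU : U * Matrix.diagonal (d ∘ e.symm) = A * (U : Matrix ι ι ℂ) := by
    ext i j
    have h := congrArg (fun v : EuclideanSpace ℂ ι => v i) (hb (e.symm j))
    rw [Matrix.mul_diagonal, Matrix.mul_apply]
    simpa [U, Module.Basis.toMatrix_apply, Matrix.mulVec, dotProduct, mul_comm] using h.symm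
  rw [Unitary.conjStarAlgAut_apply, hAU, mul_assoc, Unitary.mul_star_self_of_mem U.2, mul_one]

theorem roots_charpoly_conjStarAlgAut_diagonal (U : Matrix.unitaryGroup ι ℂ) (d : ι → ℂ) :
    (Unitary.conjStarAlgAut ℂ _ U (Matrix.diagonal d)).charpoly.roots = Finset.univ.val.map d := by
  rw [Unitary.conjStarAlgAut_apply, Matrix.charpoly_mul_comm, ← mul_assoc,
    Unitary.star_mul_self_of_mem U.2, one_mul, Matrix.charpoly_diagonal,
    ← Polynomial.roots_multiset_prod_X_sub_C (Finset.univ.val.map d), Multiset.map_map]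
  rfl

theorem trace_conjStarAlgAut (U : Matrix.unitaryGroup ι ℂ) (M : Matrix ι ι ℂ) :
    (Unitary.conjStarAlgAut ℂ _ U M).trace = M.trace := by
  rw [Unitary.conjStarAlgAut_apply, Matrix.trace_mul_comm, ← mul_assoc,
    Unitary.star_mul_self_of_mem U.2, one_mul]

open scoped Matrix.Norms.Operator in
theorem exp_conjStarAlgAut (U : Matrix.unitaryGroup ι ℂ) (M : Matrix ι ι ℂ) :
    NormedSpace.exp (Unitary.conjStarAlgAut ℂ _ U M) =
      Unitary.conjStarAlgAut ℂ _ U (NormedSpace.exp M) := by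
  refine (NormedSpace.map_exp (Unitary.conjStarAlgAut ℂ (Matrix ι ι ℂ) U) ?_ M).symm
  exact (continuous_const.mul continuous_id).mul continuous_const

theorem trace_exp_smul_mul_star_exp_smul (A : Matrix ι ι ℂ) [IsStarNormal A] (s : ℂ) :
    (NormedSpace.exp (s • A) * star (NormedSpace.exp (s • A))).trace =
      ((A.charpoly.roots.map fun z => ‖Complex.exp (s * z)‖ ^ 2).sum : ℝ) := by
  obtain ⟨U, d, rfl⟩ := exists_conjStarAlgAut_diagonal_eq_of_isStarNormal A
  rw [roots_charpoly_conjStarAlgAut_diagonal, ← map_smul, exp_conjStarAlgAut, ← map_star, ← map_mul,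
    trace_conjStarAlgAut, ← Matrix.diagonal_smul, Matrix.exp_diagonal, Matrix.star_eq_conjTranspose,
    Matrix.diagonal_conjTranspose, Matrix.diagonal_mul_diagonal, Matrix.trace_diagonal,
    Multiset.map_map]
  refine (Finset.sum_congr rfl fun i _ => ?_).trans (Complex.ofReal_sum _ _).symm
  rw [Function.comp_apply, Complex.ofReal_pow, ← Complex.mul_conj', Complex.exp_eq_exp_ℂ]
  simp [Pi.coe_exp]

open scoped Matrix.Norms.Operator in
theorem map_algebraMap_exp (M : Matrix ι ι ℝ) :
    (NormedSpace.exp M).map (algebraMap ℝ ℂ) = NormedSpace.exp (M.map (algebraMap ℝ ℂ)) :=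
  NormedSpace.map_exp (algebraMap ℝ ℂ).mapMatrix
    (continuous_id.matrix_map Complex.continuous_ofReal) M

theorem trace_exp_smul_mul_transpose_exp_smul {n : ℕ} {L : Matrix (Fin n) (Fin n) ℝ}
    (hL : IsStarNormal L) (s : ℝ) :
    (NormedSpace.exp (s • L) * (NormedSpace.exp (s • L))ᵀ).trace =
      ((complexEigenvalues L).map fun z => ‖Complex.exp (s * z)‖ ^ 2).sum := by
  have := isStarNormal_map_algebraMap hL
  have hsmul : (s • L).map (algebraMap ℝ ℂ) = (s : ℂ) • L.map (algebraMap ℝ ℂ) :=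
    Matrix.map_smul' _ s L (map_mul _)
  rw [← Complex.ofReal_inj, complexEigenvalues, ← trace_exp_smul_mul_star_exp_smul, ← hsmul,
    ← map_algebraMap_exp, ← map_algebraMap_star, ← Matrix.map_mul]
  exact AddMonoidHom.map_trace Complex.ofRealHom.toAddMonoidHom
    (NormedSpace.exp (s • L) * (NormedSpace.exp (s • L))ᵀ)

end SpectralTheorem

section Parseval

theorem integral_neg_eq_integral_add_comp_neg {E : Type*} [NormedAddCommGroup E] [NormedSpace ℝ E]
    {F : ℝ → E} {a : ℝ} (hF : IntervalIntegrable F volume (-a) a) :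
    ∫ s in -a..a, F s = ∫ s in (0 : ℝ)..a, (F s + F (-s)) := by
  have h0 : (0 : ℝ) ∈ Set.uIcc (-a) a := by
    rw [Set.mem_uIcc]
    rcases le_total 0 a with ha | ha
    · exact Or.inl ⟨by linarith, ha⟩
    · exact Or.inr ⟨ha, by linarith⟩
  have hleft : IntervalIntegrable F volume (-a) 0 :=
    hF.mono_set (Set.uIcc_subset_uIcc_left h0)
  have hright : IntervalIntegrable F volume 0 a :=
    hF.mono_set (Set.uIcc_subset_uIcc_right h0)
  have hneg : IntervalIntegrable (fun s => F (-s)) volume 0 a := by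
    simpa using ((IntervalIntegrable.iff_comp_neg (by finiteness)).1 hleft).symm
  rw [← intervalIntegral.integral_add_adjacent_intervals hleft hright,
    intervalIntegral.integral_add hright hneg, intervalIntegral.integral_comp_neg, neg_zero,
    add_comm]

theorem memLp_comp_abs {E : Type*} [NormedAddCommGroup E] {f : ℝ → E} {p : ℝ≥0∞} {a : ℝ}
    (hf : MemLp f p (volume.restrict (Set.Ioc 0 a))) :
    MemLp (fun s => f |s|) p (volume.restrict (Set.Ioc (-a) a)) := by
  have hF : MemLp ((Set.Ioc 0 a).indicator f) p volume :=
    (memLp_indicator_iff_restrict measurableSet_Ioc).2 hf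
  refine ((hF.add (hF.comp_measurePreserving (Measure.measurePreserving_neg volume))).restrict
    _).ae_eq ?_
  filter_upwards [ae_restrict_mem measurableSet_Ioc,
    ae_restrict_of_ae (Measure.ae_ne volume (0 : ℝ))] with s hs hs0
  rcases hs0.lt_or_gt with hneg | hpos
  · have hmem : -s ∈ Set.Ioc 0 a := ⟨neg_pos.2 hneg, by linarith [hs.1]⟩
    simp [abs_of_neg hneg, hmem, hneg.not_gt]
  · have hmem : s ∈ Set.Ioc 0 a := ⟨hpos, hs.2⟩
    simp [abs_of_pos hpos, hmem, hpos.not_gt]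

theorem intervalIntegrable_comp_abs {E : Type*} [NormedAddCommGroup E] {f : ℝ → E} {a : ℝ}
    (ha : 0 ≤ a) (hf : IntervalIntegrable f volume 0 a) :
    IntervalIntegrable (fun s => f |s|) volume (-a) a := by
  rw [intervalIntegrable_iff_integrableOn_Ioc_of_le ha] at hf
  rw [intervalIntegrable_iff_integrableOn_Ioc_of_le (neg_le_self ha)]
  exact memLp_one_iff_integrable.1 (memLp_comp_abs (memLp_one_iff_integrable.2 hf))

theorem integral_comp_abs_mul {𝕜 : Type*} [RCLike 𝕜] {f h : ℝ → 𝕜} {a : ℝ} (ha : 0 ≤ a)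
    (hf : IntervalIntegrable f volume 0 a) (hh : Continuous h) :
    ∫ s in -a..a, f |s| * h s = ∫ s in (0 : ℝ)..a, f s * (h s + h (-s)) := by
  rw [integral_neg_eq_integral_add_comp_neg
    ((intervalIntegrable_comp_abs ha hf).mul_continuousOn hh.continuousOn)]
  refine intervalIntegral.integral_congr fun s hs => ?_
  rw [Set.uIcc_of_le ha] at hs
  simp only [abs_neg, abs_of_nonneg hs.1, mul_add]

-- Even reflection and a half-frequency twist turn the cosine system on `[0, 1]` into the Fourier
-- system on `[-1, 1]`.
theorem fourierCoeffOn_comp_abs_mul_exp {f : ℝ → ℂ} (hf : IntervalIntegrable f volume 0 1)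
    (h : (-1 : ℝ) < 1) (n : ℤ) :
    fourierCoeffOn h (fun s => f |s| * Complex.exp ((-(Real.pi / 2 * s) : ℝ) * Complex.I)) n =
      ∫ s in (0 : ℝ)..1, f s * Complex.cos (((n : ℂ) + 1 / 2) * Real.pi * s) := by
  have hmul : ∀ s : ℝ, fourier (-n) (s : AddCircle (1 - -1 : ℝ)) •
      (f |s| * Complex.exp ((-(Real.pi / 2 * s) : ℝ) * Complex.I)) =
        f |s| * Complex.exp (-(((n : ℂ) + 1 / 2) * Real.pi * s) * Complex.I) := fun s => by
    rw [fourier_coe_apply, smul_eq_mul, mul_left_comm, ← Complex.exp_add]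
    congr 2
    push_cast
    ring
  rw [fourierCoeffOn_eq_integral]
  simp_rw [hmul]
  rw [integral_comp_abs_mul zero_le_one hf (by fun_prop), ← intervalIntegral.integral_smul]
  congr 1
  ext s
  simp only [Complex.cos, Complex.real_smul]
  push_cast
  ring_nf

theorem hasSum_sq_integral_mul_cos {f : ℝ → ℂ}
    (hf : MemLp f 2 (volume.restrict (Set.Ioc 0 1))) :
    HasSum (fun k : ℕ =>
        2 * ‖∫ s in (0 : ℝ)..1, f s * Complex.cos (((k : ℂ) + 1 / 2) * Real.pi * s)‖ ^ 2)
      (∫ s in (0 : ℝ)..1, ‖f s‖ ^ 2) := by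
  have hf_int : IntervalIntegrable f volume 0 1 :=
    (intervalIntegrable_iff_integrableOn_Ioc_of_le zero_le_one).2 (hf.integrable one_le_two)
  have hf_sq_int : IntervalIntegrable (fun s => ‖f s‖ ^ 2) volume 0 1 :=
    (intervalIntegrable_iff_integrableOn_Ioc_of_le zero_le_one).2
      (hf.integrable_norm_pow two_ne_zero)
  have hnorm : ∀ s : ℝ, ‖f |s| * Complex.exp ((-(Real.pi / 2 * s) : ℝ) * Complex.I)‖ = ‖f |s|‖ :=
    fun s => by rw [norm_mul, Complex.norm_exp_ofReal_mul_I, mul_one]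
  have hmem : MemLp (fun s => f |s| * Complex.exp ((-(Real.pi / 2 * s) : ℝ) * Complex.I)) 2
      (volume.restrict (Set.Ioc (-1) 1)) :=
    (memLp_comp_abs hf).mono ((memLp_comp_abs hf).1.mul (by fun_prop))
      (Eventually.of_forall fun s => (hnorm s).le)
  have hsum := (hasSum_sq_fourierCoeffOn (by norm_num) hmem).nat_add_neg_add_one
  have hsymm : ∀ (k : ℕ) (s : ℝ), Complex.cos ((((-(k + 1 : ℤ) : ℤ) : ℂ) + 1 / 2) * Real.pi * s) =
      Complex.cos (((k : ℂ) + 1 / 2) * Real.pi * s) := fun k s => by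
    rw [← Complex.cos_neg]
    congr 1
    push_cast
    ring
  have hval : (1 - -1 : ℝ)⁻¹ • ∫ s in (-1 : ℝ)..1, ‖f |s|‖ ^ 2 = ∫ s in (0 : ℝ)..1, ‖f s‖ ^ 2 := by
    have h := integral_comp_abs_mul zero_le_one hf_sq_int (continuous_const (y := 1))
    simp only [mul_one, intervalIntegral.integral_mul_const] at h
    rw [h, smul_eq_mul]
    ring
  simp_rw [fourierCoeffOn_comp_abs_mul_exp hf_int, hsymm, Int.cast_natCast, ← two_mul, hnorm, hval]
    at hsum
  exact hsum

theorem integral_comp_indicator_Iic {E E' : Type*} [Zero E] [NormedAddCommGroup E']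
    [NormedSpace ℝ E'] {φ : ℝ → E → E'} (hφ : ∀ s, φ s 0 = 0) (F : ℝ → E) {a b t : ℝ}
    (ht : t ∈ Set.Icc a b) :
    ∫ s in a..b, φ s ((Set.Iic t).indicator F s) = ∫ s in a..t, φ s (F s) := by
  rw [← intervalIntegral.integral_indicator ht]
  congr 1
  ext s
  by_cases hs : s ≤ t <;> simp [hs, hφ]

theorem hasSum_sq_norm_phiCos {t : ℝ} (ht : t ∈ Set.Icc (0 : ℝ) 1) (z : ℂ) :
    HasSum (fun k : ℕ => 2 * ‖phiCos klFreq (k + 1) t z‖ ^ 2)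
      (∫ s in (0 : ℝ)..t, ‖Complex.exp ((t - s : ℝ) * z)‖ ^ 2) := by
  set F : ℝ → ℂ := fun s => Complex.exp ((t - s : ℝ) * z) with hF
  have hFc : Continuous F := by fun_prop
  have hmem : MemLp ((Set.Iic t).indicator F) 2 (volume.restrict (Set.Ioc 0 1)) :=
    ((memLp_two_iff_integrable_sq_norm hFc.aestronglyMeasurable).2
      (hFc.norm.pow 2).integrableOn_Ioc).indicator measurableSet_Iic
  have hphi : ∀ k : ℕ, phiCos klFreq (k + 1) t z = ∫ s in (0 : ℝ)..1,
      (Set.Iic t).indicator F s * Complex.cos (((k : ℂ) + 1 / 2) * Real.pi * s) := fun k => by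
    rw [integral_comp_indicator_Iic
      (φ := fun s w => w * Complex.cos (((k : ℂ) + 1 / 2) * Real.pi * s)) (by simp) F ht, phiCos]
    have hfreq : (klFreq (k + 1) : ℂ) = ((k : ℂ) + 1 / 2) * Real.pi := by
      simp only [klFreq]
      push_cast
      ring
    simp only [hF, hfreq, Complex.ofReal_sub]
  have hsq : ∫ s in (0 : ℝ)..t, ‖F s‖ ^ 2 = ∫ s in (0 : ℝ)..1, ‖(Set.Iic t).indicator F s‖ ^ 2 :=
    (integral_comp_indicator_Iic (φ := fun _ w => ‖w‖ ^ 2) (by simp) F ht).symm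
  rw [hsq]
  simp_rw [hphi]
  exact hasSum_sq_integral_mul_cos hmem

theorem hasSum_multiset_sum_sq_norm_phiCos {t : ℝ} (ht : t ∈ Set.Icc (0 : ℝ) 1) (m : Multiset ℂ) :
    HasSum (fun k : ℕ => 2 * (m.map fun z => ‖phiCos klFreq (k + 1) t z‖ ^ 2).sum)
      (∫ s in (0 : ℝ)..t, (m.map fun z => ‖Complex.exp ((t - s : ℝ) * z)‖ ^ 2).sum) := by
  have hcont : ∀ z : ℂ, Continuous fun s : ℝ => ‖Complex.exp ((t - s : ℝ) * z)‖ ^ 2 := fun z => by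
    fun_prop
  induction m using Multiset.induction with
  | empty => simp
  | cons z m ih =>
    simp_rw [Multiset.map_cons, Multiset.sum_cons, mul_add]
    rw [intervalIntegral.integral_add ((hcont z).intervalIntegrable 0 t)
      ((continuous_multiset_sum m fun w _ => hcont w).intervalIntegrable 0 t)]
    exact (hasSum_sq_norm_phiCos ht z).add ih

end Parseval

theorem corollary5_general {Ω : Type*} [MeasurableSpace Ω] (P : Measure Ω)
    {n : ℕ} (L B : Matrix (Fin n) (Fin n) ℝ) (c : ℝ)
    (hB : B * Bᵀ = c ^ 2 • (1 : Matrix (Fin n) (Fin n) ℝ)) (hL : IsStarNormal L)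
    (W : ℝ≥0 → Ω → EuclideanSpace ℝ (Fin n)) (hW : IsStandardWiener W P)
    (x₀ : EuclideanSpace ℝ (Fin n))
    (X : ℝ≥0 → Ω → EuclideanSpace ℝ (Fin n)) (hX : IsLinearSDESolution L B W x₀ X P)
    (t : ℝ≥0) (ht : t ≤ 1) :
    MemLp (X t) 2 P ∧
    Summable (fun k : ℕ =>
      ((complexEigenvalues L).map fun z => ‖phiCos klFreq (k + 1) t z‖ ^ 2).sum) ∧
    ∫ ω, ‖X t ω‖ ^ 2 ∂P =
      ‖(NormedSpace.exp ((t : ℝ) • L)).toEuclideanLin x₀‖ ^ 2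
        + 2 * c ^ 2 * ∑' k : ℕ,
          ((complexEigenvalues L).map fun z => ‖phiCos klFreq (k + 1) t z‖ ^ 2).sum := by
  have hparseval := hasSum_multiset_sum_sq_norm_phiCos ⟨t.coe_nonneg, NNReal.coe_le_one.2 ht⟩
    (complexEigenvalues L)
  have hsummable := (summable_mul_left_iff two_ne_zero).1 hparseval.summable
  have htrace : ∀ s : ℝ, (NormedSpace.exp (s • L) * B * (NormedSpace.exp (s • L) * B)ᵀ).trace =
      c ^ 2 * ((complexEigenvalues L).map fun z => ‖Complex.exp (s * z)‖ ^ 2).sum := fun s => by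
    rw [Matrix.transpose_mul, Matrix.mul_assoc, ← Matrix.mul_assoc B, hB, Matrix.smul_mul,
      Matrix.one_mul, Matrix.mul_smul, Matrix.trace_smul, smul_eq_mul,
      trace_exp_smul_mul_transpose_exp_smul hL]
  refine ⟨hX.memLp_two hW t, hsummable, ?_⟩
  simp_rw [hX.integral_norm_sq hW t, htrace, intervalIntegral.integral_const_mul]
  rw [← hparseval.tsum_eq, tsum_mul_left]
  ring

theorem corollary5 {Ω : Type*} [MeasurableSpace Ω] (P : Measure Ω) [IsProbabilityMeasure P]
    {n : ℕ} (L B : Matrix (Fin n) (Fin n) ℝ) (c : ℝ)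
    (hB : B = c • (1 : Matrix (Fin n) (Fin n) ℝ)) (hL : IsStarNormal L)
    (W : ℝ≥0 → Ω → EuclideanSpace ℝ (Fin n)) (hW : IsStandardWiener W P)
    (x₀ : EuclideanSpace ℝ (Fin n))
    (X : ℝ≥0 → Ω → EuclideanSpace ℝ (Fin n)) (hX : IsLinearSDESolution L B W x₀ X P)
    (t : ℝ≥0) (ht : t ≤ 1) :
    MemLp (X t) 2 P ∧
    Summable (fun k : ℕ =>
      ((complexEigenvalues L).map fun z => ‖phiCos klFreq (k + 1) t z‖ ^ 2).sum) ∧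
    ∫ ω, ‖X t ω‖ ^ 2 ∂P =
      ‖(NormedSpace.exp ((t : ℝ) • L)).toEuclideanLin x₀‖ ^ 2
        + 2 * c ^ 2 * ∑' k : ℕ,
          ((complexEigenvalues L).map fun z => ‖phiCos klFreq (k + 1) t z‖ ^ 2).sum :=
  corollary5_general P L B c (by simp [hB, sq, smul_smul]) hL W hW x₀ X hX t ht
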